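/- **Setting.** For a finite vertex set $V$ and $d\colon V\to\mathbb{N}=\{0,1,2,\dots\}$ with even total $\sum_v d_v$, the configuration model with degree sequence $d$ is the law of the random multigraph (loops and multiple edges allowed) obtained by attaching $d_v$ half-edges to each vertex $v$ and matching all half-edges by a uniformly random perfect matching. A multigraph is identified with its adjacency matrix, a loop at $v$ counting twice in the entry $(v,v)$ and in the degree of $v$, but as one edge. **Lemma 1.3.** For each $n$ let $d^{(n)}_1,\dots,d^{(n)}_n$ be non-negative integers with sum $D^{(n)}$, where $D^{(n)}$ is even and positive for all large $n$, and let $\mathcal G=\mathcal G^{(n)}$ be drawn from the configuration model with this degree sequence. Suppose that for every $C>0$ and every $\varepsilon>0$ there is $N(C,\varepsilon)$ such that $$\sum_{i=1}^n \mathbf 1\{d^{(n)}_i< C\sqrt{D^{(n)}/n}\}\le \varepsilon n\qquad\text{for all } n>N(C,\varepsilon).$$ Then for every $C>0$ and $\varepsilon>0$ there is, for each $n$, a rule assigning to each multigraph $\mathcal G$ on $\{1,\dots,n\}$ a set $R(\mathcal G)$ of vertices such that, writing $\tilde{\mathcal G}$ for the multigraph on the remaining vertices obtained from $\mathcal G$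 by removing the vertices in $R(\mathcal G)$ and all edges with an endpoint in $R(\mathcal G)$: With probability tending to $1$ as $n\to\infty$, $|R(\mathcal G)|\le 2\varepsilon n$, and 1. the number of edges removed is at most $4\varepsilon C\sqrt{nD^{(n)}}$; 2. every vertex of $\tilde{\mathcal G}$ has degree in $\tilde{\mathcal G}$ larger than $C\sqrt{D^{(n)}/n}$. Moreover, 3. for every $n$, conditionally on the set of remaining vertices and on their degrees in $\tilde{\mathcal G}$ (for all values of these that have positive probability), the law of $\tilde{\mathcal G}$ is the configuration model on the remaining vertices with these degrees. -/

import Mathlib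

open MeasureTheory ProbabilityTheory Filter Topology

/-- The half-edges of a degree sequence `d`: the vertex `v` carries `d v` of them. -/
abbrev HalfEdge {V : Type*} (d : V → ℕ) : Type _ := Σ v : V, Fin (d v)

/-- Perfect matchings of the half-edges: involutions without fixed points, sending each half-edge
to the half-edge it is matched with. -/
abbrev PerfectMatching {V : Type*} (d : V → ℕ) : Type _ :=
  {m : Equiv.Perm (HalfEdge d) // ∀ h, m h ≠ h ∧ m (m h) = h}

/-- Every event about the (finitely many) perfect matchings is measurable. -/
instance {V : Type*} (d : V → ℕ) : MeasurableSpace (PerfectMatching d) := ⊤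

/-- Every event about multigraphs, which are given by their adjacency matrices, is measurable
(there are only countably many multigraphs on a finite vertex set). -/
instance {V : Type*} : MeasurableSpace (Matrix V V ℕ) := ⊤

/-- The multigraph obtained from a perfect matching of the half-edges, given by its adjacency
matrix: the entry at `(v, w)` counts the pairs (half-edge of `v`, half-edge of `w`) matched with
each other. A loop at `v` contributes `2` to the entry at `(v, v)`. -/
def PerfectMatching.graph {V : Type*} [DecidableEq V] {d : V → ℕ} (m : PerfectMatching d) :
    Matrix V V ℕ :=
  Matrix.of fun v w => ∑ s : Fin (d v), ∑ t : Fin (d w), if m.1 ⟨v, s⟩ = ⟨w, t⟩ then 1 else 0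

/-- The configuration model with degree sequence `d`: the law of the multigraph obtained from a
uniformly random perfect matching of the half-edges. (It is a probability measure exactly when a
perfect matching exists, that is, when the total degree is even.) -/
noncomputable def configurationModel {V : Type*} [Fintype V] [DecidableEq V] (d : V → ℕ) :
    Measure (Matrix V V ℕ) :=
  (uniformOn (Set.univ : Set (PerfectMatching d))).map PerfectMatching.graph

namespace Multigraph

/-- The degree of a vertex in the multigraph with adjacency matrix `A` (loops count twice). -/
def degree {V : Type*} [Fintype V] (A : Matrix V V ℕ) (v : V) : ℕ := ∑ w, A v w

/-- The number of edges of the multigraph with adjacency matrix `A`: half the sum of the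
degrees. -/
noncomputable def edgeCount {V : Type*} [Fintype V] (A : Matrix V V ℕ) : ℝ :=
  ((∑ v, degree A v : ℕ) : ℝ) / 2

/-- The multigraph on the vertices outside `S` that remains when the vertices in `S` and all edges
with an endpoint in `S` are removed. -/
def removeVertices {V : Type*} (A : Matrix V V ℕ) (S : Finset V) :
    Matrix {v // v ∉ S} {v // v ∉ S} ℕ :=
  A.submatrix Subtype.val Subtype.val

end Multigraph

/-! A multigraph has a largest set of vertices inducing a multigraph in which all degrees exceed
`K = C √(D / n)`: its core. Peeling off one vertex of degree at most `K` after the other until the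
core is reached removes at most `K` edges per vertex. If all but `ε n` vertices have degree at least
`4 K`, at most `2 ε n` vertices are therefore removed, since otherwise the sum of their
degrees would exceed twice the number of removed edges.

For the conditional law, reveal the pairs of half-edges with an endpoint outside the core. They
determine the half-edges still to be matched, and every matching of these gives a multigraph with
the same core, because the core depends only on the removed edges and on the remaining degrees. So
the remaining half-edges are matched uniformly at random. -/

namespace Multigraph

variable {V : Type*}

/-- The degree of `v` towards `U`: the number of half-edges at `v` whose edge leads into `U`. For
`v ∈ U` this is the degree of `v` in the multigraph induced on `U`. -/
def degreeIn (A : Matrix V V ℕ) (U : Finset V) (v : V) : ℕ := ∑ w ∈ U, A v w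

/-- The sum of the degrees in the multigraph induced on `U`, that is, twice its number of edges. -/
def degreeSumIn (A : Matrix V V ℕ) (U : Finset V) : ℕ := ∑ v ∈ U, degreeIn A U v

/-- Every degree in the multigraph induced on `U` is larger than `K`. -/
def MinDegreeAbove (K : ℝ) (A : Matrix V V ℕ) (U : Finset V) : Prop :=
  ∀ v ∈ U, K < degreeIn A U v

open Classical in
/-- The largest vertex set inducing a multigraph with all degrees larger than `K`, obtained as the
union of all such sets. -/
noncomputable def core [Fintype V] (K : ℝ) (A : Matrix V V ℕ) : Finset V :=
  (Finset.univ.filter (MinDegreeAbove K A)).sup id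

variable {A A' : Matrix V V ℕ} {S U : Finset V} {v : V} {K : ℝ}

lemma degreeIn_mono {U' : Finset V} (h : U ⊆ U') : degreeIn A U v ≤ degreeIn A U' v :=
  Finset.sum_le_sum_of_subset h

lemma degree_removeVertices [Fintype V] [DecidableEq V] (v : {v // v ∉ S}) :
    degree (removeVertices A S) v = degreeIn A Sᶜ v := by
  rw [degreeIn, Finset.sum_subtype Sᶜ (p := (· ∉ S)) (by simp)]
  rfl

lemma edgeCount_eq [Fintype V] : edgeCount A = (degreeSumIn A Finset.univ : ℝ) / 2 := rfl

lemma edgeCount_removeVertices [Fintype V] [DecidableEq V] :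
    edgeCount (removeVertices A S) = (degreeSumIn A Sᶜ : ℝ) / 2 := by
  simp only [edgeCount, degree_removeVertices]
  rw [degreeSumIn, Finset.sum_subtype Sᶜ (p := (· ∉ S)) (by simp)]

lemma degreeSumIn_le_erase_add [DecidableEq V] (hA : A.IsSymm) (hv : v ∈ U) :
    degreeSumIn A U ≤ degreeSumIn A (U.erase v) + 2 * degreeIn A U v := by
  have hto : ∑ x ∈ U.erase v, A x v ≤ degreeIn A U v :=
    calc ∑ x ∈ U.erase v, A x v = degreeIn A (U.erase v) v :=
          Finset.sum_congr rfl fun x _ => hA.apply v x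
      _ ≤ degreeIn A U v := degreeIn_mono (Finset.erase_subset v U)
  have hrest : ∑ x ∈ U.erase v, degreeIn A U x =
      ∑ x ∈ U.erase v, A x v + degreeSumIn A (U.erase v) := by
    rw [degreeSumIn, ← Finset.sum_add_distrib]
    exact Finset.sum_congr rfl fun x _ => (Finset.add_sum_erase U (A x) hv).symm
  rw [degreeSumIn, ← Finset.add_sum_erase U _ hv, hrest]
  lia

lemma sum_degree_compl_add_degreeSumIn_le [Fintype V] [DecidableEq V] :
    ∑ v ∈ Uᶜ, degree A v + degreeSumIn A U ≤ degreeSumIn A Finset.univ :=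
  calc ∑ v ∈ Uᶜ, degree A v + degreeSumIn A U
      ≤ ∑ v ∈ Uᶜ, degree A v + ∑ v ∈ U, degree A v :=
        Nat.add_le_add_left (Finset.sum_le_sum fun _ _ => degreeIn_mono (Finset.subset_univ U)) _
    _ = degreeSumIn A Finset.univ := Finset.sum_compl_add_sum U (degree A)

section Core

variable [Fintype V]

lemma MinDegreeAbove.subset_core (hU : MinDegreeAbove K A U) : U ⊆ core K A := by
  classical
  exact Finset.le_sup (f := id) (by simpa using hU)

lemma minDegreeAbove_core (K : ℝ) (A : Matrix V V ℕ) : MinDegreeAbove K A (core K A) := by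
  classical
  intro v hv
  obtain ⟨U, hU, hvU⟩ := Finset.mem_sup.1 hv
  have hU : MinDegreeAbove K A U := by simpa using hU
  exact (hU v hvU).trans_le (Nat.cast_le.2 (degreeIn_mono hU.subset_core))

lemma core_congr (hout : ∀ v w, v ∉ core K A ∨ w ∉ core K A → A' v w = A v w)
    (hdeg : ∀ v ∈ core K A, degreeIn A' (core K A) v = degreeIn A (core K A) v) :
    core K A' = core K A := by
  classical
  have hdegreeIn {U : Finset V} (hU : core K A ⊆ U) (v : V) : degreeIn A' U v = degreeIn A U v := by
    by_cases hv : v ∈ core K A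
    · have hsdiff : ∑ w ∈ U \ core K A, A' v w = ∑ w ∈ U \ core K A, A v w :=
        Finset.sum_congr rfl fun w hw => hout v w (.inr (Finset.mem_sdiff.1 hw).2)
      rw [degreeIn, degreeIn, ← Finset.sum_sdiff hU, hsdiff, ← Finset.sum_sdiff hU]
      exact congrArg _ (hdeg v hv)
    · exact Finset.sum_congr rfl fun w _ => hout v w (.inl hv)
  have hsub : core K A ⊆ core K A' := MinDegreeAbove.subset_core fun v hv => by
    rw [hdegreeIn subset_rfl]
    exact minDegreeAbove_core K A v hv
  refine (MinDegreeAbove.subset_core fun v hv => ?_).antisymm hsub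
  rw [← hdegreeIn hsub]
  exact minDegreeAbove_core K A' v hv

variable [DecidableEq V]

lemma degreeSumIn_le_core_add (hA : A.IsSymm) (hU : core K A ⊆ U) :
    (degreeSumIn A U : ℝ) ≤ degreeSumIn A (core K A) + 2 * K * (U \ core K A).card := by
  induction U using Finset.strongInduction with
  | H U ih =>
    by_cases hmin : MinDegreeAbove K A U
    · simp [hU.antisymm hmin.subset_core]
    · obtain ⟨v, hvU, hv⟩ : ∃ v ∈ U, (degreeIn A U v : ℝ) ≤ K := by
        simpa [MinDegreeAbove] using hmin
      have hvcore : v ∉ core K A := fun h =>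
        (minDegreeAbove_core K A v h).not_ge ((Nat.cast_le.2 (degreeIn_mono hU)).trans hv)
      have hcard : ((U \ core K A).card : ℝ) = (U.erase v \ core K A).card + 1 := by
        rw [Finset.erase_sdiff_comm]
        exact_mod_cast (Finset.card_erase_add_one (Finset.mem_sdiff.2 ⟨hvU, hvcore⟩)).symm
      have herase := ih _ (Finset.erase_ssubset hvU) (Finset.subset_erase.2 ⟨hU, hvcore⟩)
      have hpeel : (degreeSumIn A U : ℝ) ≤ degreeSumIn A (U.erase v) + 2 * degreeIn A U v := by
        exact_mod_cast degreeSumIn_le_erase_add hA hvU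
      rw [hcard]
      linarith

lemma degreeSumIn_univ_le_core_add (hA : A.IsSymm) :
    (degreeSumIn A Finset.univ : ℝ) ≤
      degreeSumIn A (core K A) + 2 * K * (core K A)ᶜ.card := by
  rw [Finset.compl_eq_univ_sdiff]
  exact degreeSumIn_le_core_add hA (Finset.subset_univ _)

lemma edgeCount_sub_edgeCount_removeVertices_compl_core_le (hA : A.IsSymm) :
    edgeCount A - edgeCount (removeVertices A (core K A)ᶜ) ≤ K * (core K A)ᶜ.card := by
  rw [edgeCount_eq, edgeCount_removeVertices, compl_compl]
  linarith [degreeSumIn_univ_le_core_add (K := K) hA]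

lemma lt_degree_removeVertices_compl_core (v : {v // v ∉ (core K A)ᶜ}) :
    K < degree (removeVertices A (core K A)ᶜ) v := by
  rw [degree_removeVertices, compl_compl]
  exact minDegreeAbove_core K A v (by simpa using v.2)

lemma sum_degree_compl_core_le (hA : A.IsSymm) :
    ((∑ v ∈ (core K A)ᶜ, degree A v : ℕ) : ℝ) ≤ 2 * K * (core K A)ᶜ.card := by
  have hsum : ((∑ v ∈ (core K A)ᶜ, degree A v : ℕ) : ℝ) + degreeSumIn A (core K A) ≤
      degreeSumIn A Finset.univ := by
    exact_mod_cast sum_degree_compl_add_degreeSumIn_le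
  linarith [degreeSumIn_univ_le_core_add (K := K) hA]

lemma card_compl_core_le (hA : A.IsSymm) (hK : 0 < K) :
    ((core K A)ᶜ.card : ℝ) ≤
      2 * (Finset.univ.filter fun v => (degree A v : ℝ) < 4 * K).card := by
  set light := Finset.univ.filter fun v => (degree A v : ℝ) < 4 * K
  set R := (core K A)ᶜ
  have hheavy : (R \ light).card * (4 * K) ≤ 2 * K * R.card :=
    calc ((R \ light).card : ℝ) * (4 * K)
        ≤ ∑ v ∈ R \ light, (degree A v : ℝ) := by
          rw [← nsmul_eq_mul]
          exact Finset.card_nsmul_le_sum _ _ _ fun v hv => by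
            simpa [light] using (Finset.mem_sdiff.1 hv).2
      _ ≤ ((∑ v ∈ R, degree A v : ℕ) : ℝ) := by
          exact_mod_cast Finset.sum_le_sum_of_subset Finset.sdiff_subset
      _ ≤ 2 * K * R.card := sum_degree_compl_core_le hA
  have hcard : (R.card : ℝ) ≤ (R \ light).card + light.card := by
    exact_mod_cast Finset.card_le_card_sdiff_add_card
  have hhalf : 2 * ((R \ light).card : ℝ) ≤ R.card :=
    le_of_mul_le_mul_left (by linarith) (mul_pos two_pos hK)
  linarith

end Core

end Multigraph

section ConditionalProbability

variable {Ω Ω' β : Type*} [MeasurableSpace Ω] [MeasurableSpace Ω'] [MeasurableSpace β]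

lemma cond_map {μ : Measure Ω} {f : Ω → Ω'} (hf : Measurable f) {s : Set Ω'}
    (hs : MeasurableSet s) : (μ.map f)[|s] = (μ[|f ⁻¹' s]).map f := by
  rw [ProbabilityTheory.cond, ProbabilityTheory.cond, Measure.map_apply hf hs,
    Measure.restrict_map hf hs, Measure.map_smul]

lemma map_cond_preimage_eq_of_forall_fiber {μ : Measure Ω} [IsFiniteMeasure μ]
    {α : Type*} [Countable α] {X : Ω → α} (hX : ∀ a, MeasurableSet (X ⁻¹' {a})) {Y : Ω → β}
    (hY : Measurable Y) {ν : Measure β} {T : Set α} (hT : μ (X ⁻¹' T) ≠ 0)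
    (hν : ∀ a ∈ T, (μ[|X ⁻¹' {a}]).map Y = ν) :
    (μ[|X ⁻¹' T]).map Y = ν := by
  ext B hB
  have hfiber (a : T) : μ.restrict (Y ⁻¹' B) (X ⁻¹' {↑a}) = ν B * μ (X ⁻¹' {↑a}) := by
    rw [Measure.restrict_apply (hX a), ← cond_mul_eq_inter (hX a), ← hν a a.2,
      Measure.map_apply hY hB]
  have hinter : μ (X ⁻¹' T ∩ Y ⁻¹' B) = ν B * μ (X ⁻¹' T) := by
    rw [← Measure.restrict_apply' (hY hB),
      ← tsum_measure_preimage_singleton T.to_countable fun a _ => hX a,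
      ← tsum_measure_preimage_singleton T.to_countable fun a _ => hX a, ← ENNReal.tsum_mul_left]
    exact tsum_congr hfiber
  rw [Measure.map_apply hY hB, cond_apply' (hY hB), hinter, mul_comm (ν B),
    ENNReal.inv_mul_cancel_left hT (measure_ne_top μ _)]

lemma cond_uniformOn_univ [Finite Ω] [MeasurableSingletonClass Ω] (s : Set Ω) :
    (uniformOn (Set.univ : Set Ω))[|s] = uniformOn s := by
  rw [uniformOn, uniformOn, cond_cond_eq_cond_inter' .univ s.toFinite.measurableSet
    (Measure.count_apply_lt_top.2 Set.finite_univ).ne, Set.univ_inter]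

lemma map_uniformOn_univ_of_injective [MeasurableSingletonClass Ω] [MeasurableSingletonClass Ω']
    {f : Ω → Ω'} (hf : Function.Injective f) (hfm : Measurable f) :
    (uniformOn Set.univ).map f = uniformOn (Set.range f) := by
  ext t ht
  rw [Measure.map_apply hfm ht, uniformOn, uniformOn, cond_apply' (hfm ht), cond_apply' ht,
    Set.univ_inter, ← Measure.count_injective_image hf, ← Measure.count_injective_image hf,
    Set.image_univ, Set.image_preimage_eq_inter_range, Set.inter_comm]

end ConditionalProbability

instance {V : Type*} (d : V → ℕ) : DiscreteMeasurableSpace (PerfectMatching d) := ⟨fun _ => trivial⟩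

instance {V : Type*} : DiscreteMeasurableSpace (Matrix V V ℕ) := ⟨fun _ => trivial⟩

namespace PerfectMatching

variable {V W : Type*} {d : V → ℕ} {d' : W → ℕ}

lemma nonempty_of_even [Fintype V] (h : Even (∑ v, d v)) : Nonempty (PerfectMatching d) := by
  obtain ⟨k, hk⟩ := h
  let e : Bool × Fin k ≃ HalfEdge d := Fintype.equivOfCardEq (by simp [hk, two_mul])
  refine ⟨e.permCongr (Equiv.boolNot.prodCongr (Equiv.refl _)), fun h => ⟨fun hfix => ?_, ?_⟩⟩
  · rw [Equiv.permCongr_apply, ← Equiv.eq_symm_apply] at hfix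
    exact Bool.not_ne_self _ (congrArg Prod.fst hfix)
  · simp [Prod.map]

lemma apply_mem_of_forall_notMem_eq {m m₀ : PerfectMatching d} {I : Set (HalfEdge d)}
    (hI : ∀ h, m₀.1 h ∈ I ↔ h ∈ I) (heq : ∀ h ∉ I, m.1 h = m₀.1 h) {h : HalfEdge d} (hh : h ∈ I) :
    m.1 h ∈ I := by
  by_contra hout
  have hback : m₀.1 (m.1 h) = h := by rw [← heq _ hout, (m.2 h).2]
  exact hout ((hI _).1 (hback.symm ▸ hh))

section Splice

/-- The matching that is a copy of `m'` on the range of `ι`, which `m` preserves, and agrees with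
`m` elsewhere. -/
noncomputable def splice (ι : HalfEdge d' ↪ HalfEdge d) (m : PerfectMatching d)
    (hm : ∀ h, m.1 h ∈ Set.range ι ↔ h ∈ Set.range ι) (m' : PerfectMatching d') :
    PerfectMatching d :=
  have hinv : Function.Involutive (Function.extend ι (ι ∘ m'.1) m.1) := fun h => by
    by_cases hh : h ∈ Set.range ι
    · obtain ⟨x, rfl⟩ := hh
      simp [ι.injective.extend_apply, (m'.2 x).2]
    · rw [Function.extend_apply' _ _ _ hh, Function.extend_apply' _ _ _ (mt (hm h).1 hh), (m.2 h).2]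
  ⟨hinv.toPerm, fun h => ⟨by
    by_cases hh : h ∈ Set.range ι
    · obtain ⟨x, rfl⟩ := hh
      simp [ι.injective.extend_apply, (m'.2 x).1]
    · simp [Function.extend_apply' _ _ _ hh, (m.2 h).1], hinv h⟩⟩

variable {ι : HalfEdge d' ↪ HalfEdge d} {m : PerfectMatching d}
  (hm : ∀ h, m.1 h ∈ Set.range ι ↔ h ∈ Set.range ι)

lemma splice_apply (m' : PerfectMatching d') (x : HalfEdge d') :
    (splice ι m hm m').1 (ι x) = ι (m'.1 x) :=
  ι.injective.extend_apply _ _ x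

lemma splice_apply_of_notMem (m' : PerfectMatching d') {h : HalfEdge d} (hh : h ∉ Set.range ι) :
    (splice ι m hm m').1 h = m.1 h :=
  Function.extend_apply' _ _ h hh

lemma splice_injective : Function.Injective (splice ι m hm) := fun m₁ m₂ h =>
  Subtype.ext <| Equiv.ext fun x => ι.injective <| by
    rw [← splice_apply hm, ← splice_apply hm, h]

lemma exists_apply_eq_of_mapsTo {m : PerfectMatching d} (hm : ∀ x, m.1 (ι x) ∈ Set.range ι) :
    ∃ m' : PerfectMatching d', ∀ x, ι (m'.1 x) = m.1 (ι x) := by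
  choose f hf using hm
  have hinv : Function.Involutive f := fun x => ι.injective <| by rw [hf, hf, (m.2 _).2]
  have hne (x : HalfEdge d') : f x ≠ x := fun h => (m.2 (ι x)).1 ((hf x).symm.trans (congrArg ι h))
  exact ⟨⟨hinv.toPerm, fun x => ⟨hne x, hinv x⟩⟩, hf⟩

lemma range_splice :
    Set.range (splice ι m hm) = {m₁ | ∀ h ∉ Set.range ι, m₁.1 h = m.1 h} := by
  refine Set.Subset.antisymm ?_ fun m₁ hm₁ => ?_
  · rintro _ ⟨m', rfl⟩ h hh
    exact splice_apply_of_notMem hm m' hh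
  · obtain ⟨m', hm'⟩ := exists_apply_eq_of_mapsTo (ι := ι) fun x =>
      apply_mem_of_forall_notMem_eq hm hm₁ (Set.mem_range_self x)
    refine ⟨m', Subtype.ext (Equiv.ext fun h => ?_)⟩
    by_cases hh : h ∈ Set.range ι
    · obtain ⟨x, rfl⟩ := hh
      rw [splice_apply, hm']
    · rw [splice_apply_of_notMem hm m' hh, hm₁ h hh]

end Splice

section Graph

variable [DecidableEq V]

lemma graph_isSymm (m : PerfectMatching d) : m.graph.IsSymm := by
  have hswap (h h' : HalfEdge d) : m.1 h = h' ↔ m.1 h' = h :=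
    ⟨fun heq => heq ▸ (m.2 h).2, fun heq => heq ▸ (m.2 h').2⟩
  refine Matrix.IsSymm.ext fun v w => ?_
  simp only [graph, Matrix.of_apply, hswap ⟨w, _⟩]
  exact Finset.sum_comm

lemma graph_apply (m : PerfectMatching d) (v w : V) :
    m.graph v w = (Finset.univ.filter fun s : Fin (d v) => (m.1 ⟨v, s⟩).1 = w).card := by
  simp only [graph, Matrix.of_apply, Finset.card_filter]
  refine Finset.sum_congr rfl fun s _ => ?_
  obtain ⟨u, t⟩ := m.1 ⟨v, s⟩
  by_cases hu : u = w
  · subst hu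
    simp
  · simp [hu]

lemma graph_apply_eq_ncard (m : PerfectMatching d) (v w : V) :
    m.graph v w = {h : HalfEdge d | h.1 = v ∧ (m.1 h).1 = w}.ncard := by
  have himage : {h : HalfEdge d | h.1 = v ∧ (m.1 h).1 = w} =
      Sigma.mk v '' {s | (m.1 ⟨v, s⟩).1 = w} := by
    ext ⟨u, s⟩
    constructor
    · rintro ⟨rfl, hw⟩
      exact ⟨s, hw, rfl⟩
    · rintro ⟨t, ht, ⟨⟩⟩
      exact ⟨rfl, ht⟩
  rw [himage, Set.ncard_image_of_injective _ sigma_mk_injective, graph_apply,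
    ← Set.ncard_coe_finset, Finset.coe_filter_univ]

lemma degreeIn_graph (m : PerfectMatching d) (U : Finset V) (v : V) :
    Multigraph.degreeIn m.graph U v =
      (Finset.univ.filter fun s : Fin (d v) => (m.1 ⟨v, s⟩).1 ∈ U).card := by
  simp only [Multigraph.degreeIn, graph_apply, Finset.card_filter]
  rw [Finset.sum_comm]
  simp

lemma degree_graph [Fintype V] (m : PerfectMatching d) : Multigraph.degree m.graph = d :=
  funext fun v => (degreeIn_graph m Finset.univ v).trans (by simp)

end Graph

section OuterPart

/-- The half-edges that survive the removal of the vertices in `S`: those which are attached outside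
`S` and matched with a half-edge outside `S`. -/
def innerHalfEdges (S : Finset V) (m : PerfectMatching d) : Set (HalfEdge d) :=
  {h | h.1 ∉ S ∧ (m.1 h).1 ∉ S}

open Classical in
/-- The part of the matching that is revealed by the edges with an endpoint in `S`: the partners of
the half-edges that do not survive the removal of `S`. The surviving ones are sent to `none`. -/
noncomputable def outerPart (S : Finset V) (m : PerfectMatching d) :
    HalfEdge d → Option (HalfEdge d) :=
  fun h => if h ∈ innerHalfEdges S m then none else some (m.1 h)

variable {S : Finset V} {m m₀ : PerfectMatching d}

lemma apply_mem_innerHalfEdges {h : HalfEdge d} :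
    m.1 h ∈ innerHalfEdges S m ↔ h ∈ innerHalfEdges S m := by
  simp only [innerHalfEdges, Set.mem_ofPred_eq, (m.2 h).2, and_comm]

lemma innerHalfEdges_eq_of_outerPart_eq (h : outerPart S m = outerPart S m₀) :
    innerHalfEdges S m = innerHalfEdges S m₀ := by
  have hnone (m : PerfectMatching d) : innerHalfEdges S m = {h | outerPart S m h = none} := by
    ext
    simp [outerPart]
  rw [hnone, hnone, h]

lemma outerPart_eq_iff :
    outerPart S m = outerPart S m₀ ↔ ∀ h ∉ innerHalfEdges S m₀, m.1 h = m₀.1 h := by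
  refine ⟨fun heq h hh => ?_, fun hout => ?_⟩
  · have hh' := innerHalfEdges_eq_of_outerPart_eq heq ▸ hh
    simpa [outerPart, hh, hh'] using congrFun heq h
  · have hmem (h : HalfEdge d) : h ∈ innerHalfEdges S m ↔ h ∈ innerHalfEdges S m₀ := by
      refine ⟨fun hh => ?_, fun hh => ⟨hh.1, ?_⟩⟩
      · by_contra hh₀
        exact hh₀ ⟨hh.1, hout h hh₀ ▸ hh.2⟩
      · exact (apply_mem_of_forall_notMem_eq (fun _ => apply_mem_innerHalfEdges) hout hh).1
    funext h
    by_cases hh : h ∈ innerHalfEdges S m₀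
    · simp [outerPart, hmem, hh]
    · simp [outerPart, hmem, hh, hout h hh]

variable [DecidableEq V]

lemma graph_apply_eq_of_outerPart_eq (heq : outerPart S m = outerPart S m₀) {v w : V}
    (hvw : v ∈ S ∨ w ∈ S) : m.graph v w = m₀.graph v w := by
  rw [graph_apply, graph_apply]
  refine congrArg Finset.card (Finset.filter_congr fun s _ => ?_)
  by_cases hs : ⟨v, s⟩ ∈ innerHalfEdges S m₀
  · have hs' : ⟨v, s⟩ ∈ innerHalfEdges S m := innerHalfEdges_eq_of_outerPart_eq heq ▸ hs
    have hw : w ∈ S := hvw.resolve_left hs.1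
    exact iff_of_false (fun h => hs'.2 (h.symm ▸ hw)) fun h => hs.2 (h.symm ▸ hw)
  · rw [outerPart_eq_iff.1 heq _ hs]

lemma removeVertices_graph_splice {d' : {v // v ∉ S} → ℕ} {ι : HalfEdge d' ↪ HalfEdge d}
    (hrange : Set.range ι = innerHalfEdges S m) (hι : ∀ x, (ι x).1 = x.1)
    (hm : ∀ h, m.1 h ∈ Set.range ι ↔ h ∈ Set.range ι) (m' : PerfectMatching d') :
    Multigraph.removeVertices (splice ι m hm m').graph S = m'.graph := by
  ext v w
  rw [Multigraph.removeVertices, Matrix.submatrix_apply, graph_apply_eq_ncard,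
    graph_apply_eq_ncard, ← Set.ncard_image_of_injective _ ι.injective]
  congr 1
  ext h
  by_cases hh : h ∈ Set.range ι
  · obtain ⟨x, rfl⟩ := hh
    simp [splice_apply, hι, Subtype.ext_iff]
  · refine iff_of_false (fun ⟨hv, hw⟩ => hh ?_) fun hmem => hh (Set.image_subset_range _ _ hmem)
    rw [splice_apply_of_notMem hm m' hh] at hw
    exact hrange ▸ ⟨hv ▸ v.2, hw ▸ w.2⟩

variable [Fintype V]

open Classical in
lemma degree_removeVertices_graph (m : PerfectMatching d) (v : {v // v ∉ S}) :
    Multigraph.degree (Multigraph.removeVertices m.graph S) v =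
      Fintype.card {s : Fin (d v) // ⟨v, s⟩ ∈ innerHalfEdges S m} := by
  rw [Multigraph.degree_removeVertices, degreeIn_graph, Fintype.card_subtype]
  congr! 3 with s
  simp [innerHalfEdges, v.2]

lemma degree_removeVertices_graph_eq_of_outerPart_eq (heq : outerPart S m = outerPart S m₀) :
    Multigraph.degree (Multigraph.removeVertices m.graph S) =
      Multigraph.degree (Multigraph.removeVertices m₀.graph S) := by
  classical
  funext v
  rw [degree_removeVertices_graph, degree_removeVertices_graph]
  simp only [innerHalfEdges_eq_of_outerPart_eq heq]

lemma exists_embedding_range_eq_innerHalfEdges (S : Finset V) (m : PerfectMatching d) :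
    ∃ ι : HalfEdge (Multigraph.degree (Multigraph.removeVertices m.graph S)) ↪ HalfEdge d,
      Set.range ι = innerHalfEdges S m ∧ ∀ x, (ι x).1 = x.1 := by
  classical
  let e (v : {v // v ∉ S}) :=
    (Fintype.equivFinOfCardEq (degree_removeVertices_graph m v).symm).symm
  refine ⟨⟨Sigma.map Subtype.val fun v i => (e v i).1, Subtype.val_injective.sigma_map fun v =>
    Subtype.val_injective.comp (e v).injective⟩, Set.Subset.antisymm ?_ ?_, fun _ => rfl⟩
  · rintro _ ⟨⟨v, i⟩, rfl⟩
    exact (e v i).2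
  · rintro ⟨v, s⟩ hs
    obtain ⟨i, hi⟩ := (e ⟨v, hs.1⟩).surjective ⟨s, hs⟩
    exact ⟨⟨⟨v, hs.1⟩, i⟩, congrArg (Sigma.mk v) (congrArg Subtype.val hi)⟩

lemma map_uniformOn_outerPart_fiber (S : Finset V) (m : PerfectMatching d) :
    (uniformOn (outerPart S ⁻¹' {outerPart S m})).map
        (fun m₁ => Multigraph.removeVertices m₁.graph S) =
      configurationModel (Multigraph.degree (Multigraph.removeVertices m.graph S)) := by
  obtain ⟨ι, hrange, hι⟩ := exists_embedding_range_eq_innerHalfEdges S m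
  have hm (h : HalfEdge d) : m.1 h ∈ Set.range ι ↔ h ∈ Set.range ι := by
    rw [hrange, apply_mem_innerHalfEdges]
  have hfiber : outerPart S ⁻¹' {outerPart S m} = Set.range (splice ι m hm) := by
    ext m₁
    rw [range_splice, hrange]
    exact outerPart_eq_iff
  rw [hfiber, ← map_uniformOn_univ_of_injective (splice_injective hm) .of_discrete,
    Measure.map_map .of_discrete .of_discrete, configurationModel]
  exact congrArg (Measure.map · _) (funext (removeVertices_graph_splice hrange hι hm))

end OuterPart

end PerfectMatching

section ConfigurationModel

variable {V : Type*} [Fintype V] [DecidableEq V] {d : V → ℕ}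

lemma configurationModel_eq_one (hd : Even (∑ v, d v)) {B : Set (Matrix V V ℕ)}
    (hB : ∀ m : PerfectMatching d, m.graph ∈ B) : configurationModel d B = 1 := by
  have := PerfectMatching.nonempty_of_even hd
  rw [configurationModel, Measure.map_apply .of_discrete .of_discrete,
    Set.eq_univ_of_forall (s := _ ⁻¹' B) hB, measure_univ]

lemma map_removeVertices_cond_configurationModel {S : Finset V} {d' : {v // v ∉ S} → ℕ}
    {E : Set (Matrix V V ℕ)}
    (hdeg : ∀ A ∈ E, Multigraph.degree (Multigraph.removeVertices A S) = d')
    (hE : ∀ A ∈ E, ∀ A', (∀ v w, v ∈ S ∨ w ∈ S → A' v w = A v w) →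
      Multigraph.degree (Multigraph.removeVertices A' S) = d' → A' ∈ E)
    (hE₀ : configurationModel d E ≠ 0) :
    ((configurationModel d)[|E]).map (fun A => Multigraph.removeVertices A S) =
      configurationModel d' := by
  have hsat : PerfectMatching.outerPart S ⁻¹' (PerfectMatching.outerPart S ''
      (PerfectMatching.graph ⁻¹' E)) = (PerfectMatching.graph ⁻¹' E : Set (PerfectMatching d)) := by
    refine Set.Subset.antisymm ?_ (Set.subset_preimage_image _ _)
    rintro m ⟨m₀, hm₀, heq⟩
    exact hE _ hm₀ _ (fun v w => PerfectMatching.graph_apply_eq_of_outerPart_eq heq.symm)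
      ((PerfectMatching.degree_removeVertices_graph_eq_of_outerPart_eq heq.symm).trans
        (hdeg _ hm₀))
  rw [configurationModel, Measure.map_apply .of_discrete .of_discrete, ← hsat] at hE₀
  rw [configurationModel, cond_map .of_discrete .of_discrete,
    Measure.map_map .of_discrete .of_discrete, ← hsat]
  refine map_cond_preimage_eq_of_forall_fiber (fun _ => .of_discrete) .of_discrete hE₀ ?_
  rintro _ ⟨m, hm, rfl⟩
  rw [cond_uniformOn_univ, ← hdeg _ hm]
  exact PerfectMatching.map_uniformOn_outerPart_fiber S m

end ConfigurationModel

theorem lemma1p3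
    (d : (n : ℕ) → Fin n → ℕ) (D : ℕ → ℕ) (hD : ∀ n, D n = ∑ i, d n i)
    (heven : ∀ᶠ n in atTop, Even (D n))
    (hpos : ∀ᶠ n in atTop, 0 < D n)
    (hlight : ∀ C : ℝ, 0 < C → ∀ ε : ℝ, 0 < ε → ∀ᶠ n : ℕ in atTop,
      (Finset.card {i : Fin n | (d n i : ℝ) < C * √((D n : ℝ) / n)} : ℝ) ≤ ε * n)
    (C : ℝ) (hC : 0 < C) (ε : ℝ) (hε : 0 < ε) :
    -- `R n A` is the set of vertices that are removed from the graph `A`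
    ∃ R : (n : ℕ) → Matrix (Fin n) (Fin n) ℕ → Finset (Fin n),
      Tendsto
        (fun n : ℕ => configurationModel (d n)
          {A | ((R n A).card : ℝ) ≤ 2 * ε * n ∧
            Multigraph.edgeCount A - Multigraph.edgeCount (Multigraph.removeVertices A (R n A))
              ≤ 4 * ε * C * √((n : ℝ) * D n) ∧
            ∀ v, C * √((D n : ℝ) / n) <
              (Multigraph.degree (Multigraph.removeVertices A (R n A)) v : ℝ)})
        atTop (𝓝 1) ∧
      -- given the remaining vertices and their degrees, the rest is a configuration model
      ∀ (n : ℕ) (S : Finset (Fin n)) (d' : {v // v ∉ S} → ℕ),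
        configurationModel (d n)
          {A | R n A = S ∧ Multigraph.degree (Multigraph.removeVertices A S) = d'} ≠ 0 →
        (ProbabilityTheory.cond (configurationModel (d n))
            {A | R n A = S ∧ Multigraph.degree (Multigraph.removeVertices A S) = d'}).map
          (fun A => Multigraph.removeVertices A S) = configurationModel d' := by
  refine ⟨fun n A => (Multigraph.core (C * √((D n : ℝ) / n)) A)ᶜ, ?_, fun n S d' h₀ => ?_⟩
  · refine tendsto_const_nhds.congr' ?_
    filter_upwards [heven, hpos, hlight (4 * C) (by positivity) ε hε, eventually_gt_atTop 0]
      with n hn hDn hlight hn0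
    refine (configurationModel_eq_one (hD n ▸ hn) fun m => ?_).symm
    set K := C * √((D n : ℝ) / n) with hK
    have hcard : ((Multigraph.core K m.graph)ᶜ.card : ℝ) ≤ 2 * ε * n := by
      have hcore := Multigraph.card_compl_core_le (K := K) m.graph_isSymm (by positivity)
      simp only [m.degree_graph, hK, ← mul_assoc] at hcore
      linarith
    refine ⟨hcard, ?_, Multigraph.lt_degree_removeVertices_compl_core⟩
    have hsqrt : √((D n : ℝ) / n) * n = √((n : ℝ) * D n) := by
      rw [Real.sqrt_div (by positivity), Real.sqrt_mul (by positivity), div_mul_comm,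
        Real.div_sqrt]
    calc _ ≤ K * (Multigraph.core K m.graph)ᶜ.card :=
          Multigraph.edgeCount_sub_edgeCount_removeVertices_compl_core_le m.graph_isSymm
      _ ≤ K * (2 * ε * n) := by gcongr
      _ = 2 * ε * C * √((n : ℝ) * D n) := by rw [← hsqrt, hK]; ring
      _ ≤ 4 * ε * C * √((n : ℝ) * D n) := by gcongr; norm_num
  · refine map_removeVertices_cond_configurationModel (fun A hA => hA.2) ?_ h₀
    rintro A ⟨rfl, hdeg⟩ A' hout hdeg'
    refine ⟨congrArg (·ᶜ) (Multigraph.core_congr ?_ fun v hv => ?_), hdeg'⟩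
    · exact fun v w hvw => hout v w (by simpa using hvw)
    · simpa only [Multigraph.degree_removeVertices, compl_compl] using
        congrFun (hdeg'.trans hdeg.symm) ⟨v, by simpa using hv⟩
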